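/- Let $d\ge 1$, $r,s\ge 0$ be integers with $d=r+2s$. A real polynomial has signature $s$ if, counted with multiplicity, it has exactly $s$ pairs of complex conjugate non-real roots. For $B>0$ let $\mathcal H_d(s,B)$ be the set of vectors $(p_0,\dots,p_d)\in\mathbb R^{d+1}$ with $|p_i|\le B$ for $0\le i\le d$ such that $p_dX^d+\dots+p_1X+p_0$ has signature $s$, and put $$\mathcal H_d^*(s,B)=\{(p_0,\dots,p_{d-1})\in\mathbb R^d:\ (p_0,\dots,p_{d-1},1)\in\mathcal H_d(s,B)\},$$ $$\mathcal H_d^+(s,B)=\{(p_0,\dots,p_d)\in\mathcal H_d(s,B):\ p_d>0\}.$$ Let $H_d(s,B)$ be the set of vectors $(x_1,\dots,x_r,y_1,\dots,y_s,z_1,\dots,z_s)\in\mathbb R^d$ with $z_j\ne 0$ for $1\le j\le s$ and $$-B\le S_j(x_1,\dots,x_r,\,y_1+iz_1,\,y_1-iz_1,\dots,y_s+iz_s,\,y_s-iz_s)\le B\qquad(1\le j\le d),$$ where $S_j$ is the $j$-th elementary symmetric polynomial in $d$ variables. Write $\lambda_n$ for Lebesgue measure on $\mathbb R^n$, $\mathrm{Res}$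 for the resultant, and $R_j(X)=X^2-2y_jX+y_j^2+z_j^2$ for $1\le j\le s$. All the sets and functions occurring below are Lebesgue measurable, and all the volumes and integrals below are finite. (1) For every real $B\ge 1$, $$\lambda_d(\mathcal H_d^*(s,B))=\frac{2^s}{r!\,s!}\int_{H_d(s,B)}|\Delta_r|\,\Delta_s\,\Delta_{r,s}\prod_{j=1}^{s}|z_j|\;dx_1\cdots dx_r\,dy_1\,dz_1\cdots dy_s\,dz_s,$$ where $$\Delta_r=\prod_{1\le j<k\le r}(x_j-x_k),\qquad \Delta_s=\prod_{1\le j<k\le s}\mathrm{Res}(R_j(X),R_k(X)),\qquad \Delta_{r,s}=\prod_{j=1}^{r}\prod_{k=1}^{s}R_k(x_j).$$ (2) For every real $B>0$, $$\lambda_{d+1}(\mathcal H_d^+(s,B))=B^{d+1}\int_0^1u^d\,\lambda_d\!\left(\mathcal H_d^*\!\left(s,\tfrac1u\right)\right)du.$$ -/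

import Mathlib

open MeasureTheory Polynomial

noncomputable section

namespace BoundedHeight

/-- The polynomial `p_0 + p_1 X + ⋯ + p_d X^d` with coefficient vector `p = (p_0, …, p_d)`. -/
def toPoly {d : ℕ} (p : Fin (d + 1) → ℝ) : ℝ[X] :=
  ∑ i : Fin (d + 1), C (p i) * X ^ (i : ℕ)

/-- `P` has signature `s`: counted with multiplicity, `P` has exactly `2 s` non-real complex roots
(that is, `s` pairs of complex conjugate ones). -/
def HasSignature (P : ℝ[X]) (s : ℕ) : Prop :=
  Multiset.card ((P.aroots ℂ).filter fun w => w.im ≠ 0) = 2 * s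

/-- The set `𝓗_d(s, B)` of the vectors `(p_0, …, p_d)` with `|p_i| ≤ B` for all `i` whose
polynomial has signature `s`. -/
def coeffSet (d s : ℕ) (B : ℝ) : Set (Fin (d + 1) → ℝ) :=
  {p | (∀ i, |p i| ≤ B) ∧ HasSignature (toPoly p) s}

/-- The set `𝓗_d^*(s, B)` of the vectors `(p_0, …, p_{d-1})` such that
`(p_0, …, p_{d-1}, 1)` lies in `𝓗_d(s, B)`. -/
def coeffSetMonic (d s : ℕ) (B : ℝ) : Set (Fin d → ℝ) :=
  {p | (Fin.snoc p 1 : Fin (d + 1) → ℝ) ∈ coeffSet d s B}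

/-- The set `𝓗_d^+(s, B)` of the vectors in `𝓗_d(s, B)` with `p_d > 0`. -/
def coeffSetPos (d s : ℕ) (B : ℝ) : Set (Fin (d + 1) → ℝ) :=
  {p | p ∈ coeffSet d s B ∧ 0 < p (Fin.last d)}

/-- The space `ℝ^r × ℝ^s × ℝ^s` of the root coordinates
`(x_1, …, x_r, y_1, …, y_s, z_1, …, z_s)`, with its Lebesgue measure. -/
abbrev RootCoords (r s : ℕ) : Type := (Fin r → ℝ) × (Fin s → ℝ) × (Fin s → ℝ)

/-- The `r + 2 s` complex numbers `x_1, …, x_r, y_1 ± i z_1, …, y_s ± i z_s`. -/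
def rootFamily {r s : ℕ} (v : RootCoords r s) : Multiset ℂ :=
  (Finset.univ.val.map fun j : Fin r => (v.1 j : ℂ)) +
  ((Finset.univ.val.map fun j : Fin s => (v.2.1 j : ℂ) + v.2.2 j * Complex.I) +
   (Finset.univ.val.map fun j : Fin s => (v.2.1 j : ℂ) - v.2.2 j * Complex.I))

/-- The set `H_d(s, B)`, `d = r + 2 s`: all elementary symmetric functions `S_1, …, S_d` of the
numbers `x_j`, `y_j ± i z_j` are real numbers in `[-B, B]`, and `z_j ≠ 0` for all `j`. -/
def rootSet (r s : ℕ) (B : ℝ) : Set (RootCoords r s) :=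
  {v | (∀ j ∈ Finset.Icc 1 (r + 2 * s),
          ∃ c : ℝ, -B ≤ c ∧ c ≤ B ∧ (rootFamily v).esymm j = (c : ℂ)) ∧
       ∀ j, v.2.2 j ≠ 0}

/-- The quadratic polynomial `R = X^2 - 2 y X + y^2 + z^2` with roots `y ± i z`. -/
def quadFactor (y z : ℝ) : ℝ[X] := X ^ 2 - C (2 * y) * X + C (y ^ 2 + z ^ 2)

/-- `Δ_r = ∏_{j < k} (x_j - x_k)`. -/
def deltaReal {r s : ℕ} (v : RootCoords r s) : ℝ :=
  ∏ j : Fin r, ∏ k ∈ Finset.Ioi j, (v.1 j - v.1 k)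

/-- `Δ_s = ∏_{j < k} Res(R_j, R_k)`. -/
def deltaQuad {r s : ℕ} (v : RootCoords r s) : ℝ :=
  ∏ j : Fin s, ∏ k ∈ Finset.Ioi j,
    (quadFactor (v.2.1 j) (v.2.2 j)).resultant (quadFactor (v.2.1 k) (v.2.2 k))

/-- `Δ_{r,s} = ∏_j ∏_k R_k(x_j)`. -/
def deltaMixed {r s : ℕ} (v : RootCoords r s) : ℝ :=
  ∏ j : Fin r, ∏ k : Fin s, (quadFactor (v.2.1 k) (v.2.2 k)).eval (v.1 j)

/-- The integrand `|Δ_r| Δ_s Δ_{r,s} ∏_j |z_j|`. -/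
def rootWeight {r s : ℕ} (v : RootCoords r s) : ℝ :=
  |deltaReal v| * deltaQuad v * deltaMixed v * ∏ j : Fin s, |v.2.2 j|

end BoundedHeight

end

open MeasureTheory Polynomial

noncomputable section

namespace BoundedHeight

/-! Both formulas rest on the map $\Phi$ from root coordinates to the lower coefficients of the
monic polynomial $P=\prod_k(X-w_k)$. By Vieta, and because roots of real polynomials come in
conjugate pairs, it maps `rootSet` onto `coeffSetMonic` as soon as $B\ge 1$
(`image_coeffMap_rootSet`).

Its Jacobian $J$ needs no explicit coefficients. Freeze $w=w_i$ at the base point and differentiate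
$P(w)=\prod_k(w-w_k)$ in the coordinates: only the $k=i$ term survives. In matrix form $VJ=DM$, with
$V$ the Vandermonde matrix of the roots, $D$ diagonal with entries $-\prod_{j\ne i}(w_i-w_j)$, and
$M$ the constant matrix expressing the roots in real coordinates (`rootVandermonde_mul_jacobian`).
With $W$ the weight, $|\det V|=2^sW$, $|\det D|=(2^sW)^2$ and $|\det M|=2^s$, so $|\det J|=4^sW$
where $W\ne0$.

A group of $r!\,s!\,2^s$ measure-preserving symmetries permutes real roots and pairs and swaps
conjugates. Almost every point of `rootSet` has exactly one translate in `orderedRoots`, where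
$\Phi$ is injective. Change of variables there gives the constant $4^s/(r!\,s!\,2^s)=2^s/(r!\,s!)$.

For (2), slice by the leading coefficient $t$: scaling leaves the roots alone, so the slice is
$t\cdot\mathcal H_d^*(s,B/t)$, of volume $t^d\lambda_d(\mathcal H_d^*(s,B/t))$. Fubini and $t=Bu$
finish. -/

/-- The index type of the roots: `r` real ones and `s` pairs of complex conjugate ones. -/
abbrev RootIdx (r s : ℕ) : Type := Fin r ⊕ (Fin s ⊕ Fin s)

/-- The roots `x_j`, `y_j + i z_j`, `y_j - i z_j` as an indexed family. -/
def rootVec {r s : ℕ} (v : RootCoords r s) : RootIdx r s → ℂ :=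
  Sum.elim (fun j => (v.1 j : ℂ))
    (Sum.elim (fun j => (v.2.1 j : ℂ) + v.2.2 j * Complex.I)
      (fun j => (v.2.1 j : ℂ) - v.2.2 j * Complex.I))

/-- The real monic polynomial with root coordinates `v`. -/
def rootPoly {r s : ℕ} (v : RootCoords r s) : ℝ[X] :=
  (∏ j, (X - C (v.1 j))) * ∏ j, quadFactor (v.2.1 j) (v.2.2 j)

/-- The non-leading coefficients of the monic polynomial with root coordinates `v`. -/
def coeffMap {r s : ℕ} (v : RootCoords r s) : Fin (r + 2 * s) → ℝ :=
  fun i => (rootPoly v).coeff i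

/-! ### Roots and coefficients -/

lemma rootFamily_eq_map {r s : ℕ} (v : RootCoords r s) :
    rootFamily v = Finset.univ.val.map (rootVec v) := by
  rw [← Finset.univ_disjSum_univ, ← Finset.univ_disjSum_univ]
  simp only [Finset.val_disjSum, Multiset.disjSum, Multiset.map_add, Multiset.map_map]
  rfl

lemma card_rootFamily {r s : ℕ} (v : RootCoords r s) :
    Multiset.card (rootFamily v) = r + 2 * s := by
  simp [rootFamily]; ring

lemma map_quadFactor (y z : ℝ) :
    (quadFactor y z).map (algebraMap ℝ ℂ) =
      (X - C ((y : ℂ) + z * Complex.I)) * (X - C ((y : ℂ) - z * Complex.I)) := by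
  have h : (C (z * Complex.I) * C (z * Complex.I) : ℂ[X]) = - C ((z : ℂ) ^ 2) := by
    rw [← C_mul, ← C_neg]
    congr 1
    linear_combination (z : ℂ) ^ 2 * Complex.I_sq
  simp only [quadFactor, Polynomial.map_add, Polynomial.map_sub, Polynomial.map_mul,
    Polynomial.map_pow, map_X, map_C, Complex.coe_algebraMap,
    Complex.ofReal_mul, Complex.ofReal_pow, Complex.ofReal_ofNat, C_add, C_sub]
  simp only [C_mul, C_pow, map_ofNat] at h ⊢
  linear_combination h

lemma map_rootPoly {r s : ℕ} (v : RootCoords r s) :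
    (rootPoly v).map (algebraMap ℝ ℂ) = ∏ k, (X - C (rootVec v k)) := by
  rw [rootPoly, Polynomial.map_mul, Polynomial.map_prod, Polynomial.map_prod,
    Fintype.prod_sum_type, Fintype.prod_sum_type, ← Finset.prod_mul_distrib]
  simp only [map_quadFactor]
  simp [rootVec]

lemma map_rootPoly_eq_prod {r s : ℕ} (v : RootCoords r s) :
    (rootPoly v).map (algebraMap ℝ ℂ) = ((rootFamily v).map fun w => X - C w).prod := by
  rw [map_rootPoly, rootFamily_eq_map, Multiset.map_map]; rfl

lemma aroots_rootPoly {r s : ℕ} (v : RootCoords r s) :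
    (rootPoly v).aroots ℂ = rootFamily v := by
  rw [aroots_def, map_rootPoly_eq_prod, roots_multiset_prod_X_sub_C]

lemma monic_rootPoly {r s : ℕ} (v : RootCoords r s) : (rootPoly v).Monic := by
  have h : ((rootPoly v).map (algebraMap ℝ ℂ)).Monic := by
    rw [map_rootPoly]; exact monic_prod_of_monic _ _ fun i _ => monic_X_sub_C _
  exact monic_of_injective (algebraMap ℝ ℂ).injective h

lemma natDegree_rootPoly {r s : ℕ} (v : RootCoords r s) :
    (rootPoly v).natDegree = r + 2 * s := by
  rw [← natDegree_map_eq_of_injective (algebraMap ℝ ℂ).injective, map_rootPoly_eq_prod,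
    natDegree_multiset_prod_X_sub_C_eq_card, card_rootFamily]

lemma coeff_toPoly {d : ℕ} (p : Fin (d + 1) → ℝ) (i : Fin (d + 1)) :
    (toPoly p).coeff i = p i := by
  simp [toPoly, coeff_C_mul, coeff_X_pow, Fin.val_inj]

lemma natDegree_toPoly_le {d : ℕ} (p : Fin (d + 1) → ℝ) : (toPoly p).natDegree ≤ d :=
  natDegree_sum_le_of_forall_le _ _ fun i _ =>
    (natDegree_C_mul_X_pow_le _ _).trans (Nat.lt_succ_iff.mp i.2)

lemma toPoly_eq_of_coeff {d : ℕ} {p : Fin (d + 1) → ℝ} {P : ℝ[X]} (hP : P.natDegree ≤ d)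
    (h : ∀ i : Fin (d + 1), P.coeff i = p i) : toPoly p = P := by
  ext n
  rcases lt_or_ge n (d + 1) with hn | hn
  · rw [coeff_toPoly p ⟨n, hn⟩, ← h]
  · rw [coeff_eq_zero_of_natDegree_lt (lt_of_le_of_lt (natDegree_toPoly_le p) hn),
      coeff_eq_zero_of_natDegree_lt (lt_of_le_of_lt hP hn)]

lemma toPoly_snoc_coeffMap {r s : ℕ} (v : RootCoords r s) :
    toPoly (Fin.snoc (coeffMap v) 1 : Fin (r + 2 * s + 1) → ℝ) = rootPoly v := by
  refine toPoly_eq_of_coeff (natDegree_rootPoly v).le fun i => ?_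
  refine Fin.lastCases ?_ (fun j => ?_) i
  · have h := (monic_rootPoly v).coeff_natDegree
    rw [natDegree_rootPoly] at h
    simpa using h
  · simp [coeffMap]

lemma coeffMap_eq_iff {r s : ℕ} {v v' : RootCoords r s} :
    coeffMap v = coeffMap v' ↔ rootFamily v = rootFamily v' := by
  constructor
  · intro h
    rw [← aroots_rootPoly, ← aroots_rootPoly, ← toPoly_snoc_coeffMap, h, toPoly_snoc_coeffMap]
  · intro h
    have : rootPoly v = rootPoly v' := by
      apply map_injective (algebraMap ℝ ℂ) (algebraMap ℝ ℂ).injective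
      rw [map_rootPoly_eq_prod, map_rootPoly_eq_prod, h]
    unfold coeffMap
    rw [this]

lemma coeffMap_eq_esymm {r s : ℕ} (v : RootCoords r s) (i : Fin (r + 2 * s)) :
    (coeffMap v i : ℂ) =
      (-1) ^ (r + 2 * s - (i : ℕ)) * (rootFamily v).esymm (r + 2 * s - i) := by
  have h := Multiset.prod_X_sub_C_coeff (rootFamily v) (k := i)
    (by rw [card_rootFamily]; exact i.2.le)
  rw [card_rootFamily, ← map_rootPoly_eq_prod, coeff_map] at h
  exact h

/-- Vieta: the coefficients are the elementary symmetric functions up to sign, so these are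
automatically real. -/
lemma mem_rootSet_iff {r s : ℕ} {B : ℝ} (v : RootCoords r s) :
    v ∈ rootSet r s B ↔ (∀ i, |coeffMap v i| ≤ B) ∧ ∀ j, v.2.2 j ≠ 0 := by
  unfold rootSet
  simp only [Set.mem_ofPred_eq]
  refine and_congr_left fun _ => ⟨fun h i => ?_, fun h j hj => ?_⟩
  · obtain ⟨c, h1, h2, h3⟩ := h (r + 2 * s - i) (by simp only [Finset.mem_Icc]; omega)
    have h4 := coeffMap_eq_esymm v i
    rw [h3] at h4
    have h5 : coeffMap v i = (-1) ^ (r + 2 * s - (i : ℕ)) * c := by exact_mod_cast h4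
    rw [h5, abs_mul, abs_pow, abs_neg, abs_one, one_pow, one_mul]
    exact abs_le.mpr ⟨h1, h2⟩
  · rw [Finset.mem_Icc] at hj
    have h4 := coeffMap_eq_esymm v ⟨r + 2 * s - j, by omega⟩
    have h5 : r + 2 * s - (r + 2 * s - j) = j := by omega
    simp only [h5] at h4
    have h6 := h ⟨r + 2 * s - j, by omega⟩
    refine ⟨(-1) ^ j * coeffMap v ⟨r + 2 * s - j, by omega⟩, ?_⟩
    rw [← and_assoc, ← abs_le]
    refine ⟨by simpa [abs_mul] using h6, ?_⟩
    push_cast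
    rw [h4, ← mul_assoc, ← mul_pow]
    simp

lemma card_filter_rootFamily {r s : ℕ} {v : RootCoords r s} (hv : ∀ j, v.2.2 j ≠ 0) :
    Multiset.card ((rootFamily v).filter fun w => w.im ≠ 0) = 2 * s := by
  classical
  simp only [rootFamily, Multiset.filter_add, Multiset.card_add]
  rw [Multiset.filter_eq_nil.mpr, Multiset.filter_eq_self.mpr, Multiset.filter_eq_self.mpr]
  · simp; ring
  · simpa using hv
  · simpa using hv
  · simp

lemma aroots_map_conj (P : ℝ[X]) :
    (P.aroots ℂ).map (starRingEnd ℂ) = P.aroots ℂ := by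
  have h : (P.map (algebraMap ℝ ℂ)).map (starRingEnd ℂ) = P.map (algebraMap ℝ ℂ) := by
    rw [Polynomial.map_map]; congr 1; ext x; simp
  have h2 := (IsAlgClosed.splits (P.map (algebraMap ℝ ℂ))).roots_map (starRingEnd ℂ)
  rw [h] at h2
  exact h2.symm

lemma exists_fin_map {α : Type*} {n : ℕ} (m : Multiset α) (h : Multiset.card m = n) :
    ∃ f : Fin n → α, m = Finset.univ.val.map f := by
  subst h
  induction m using Quotient.inductionOn with
  | h l => exact ⟨fun i => l.get i, by
      rw [Fin.univ_val_map]
      exact congrArg _ (List.ofFn_get l).symm⟩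

/-- A multiset of `r + 2 s` complex numbers that is stable under conjugation and has exactly
`2 s` non-real members is a family of root coordinates. -/
lemma exists_rootFamily_eq {r s : ℕ} {m : Multiset ℂ} (hc : Multiset.card m = r + 2 * s)
    (hm : m.map (starRingEnd ℂ) = m)
    (hs : Multiset.card (m.filter fun w => w.im ≠ 0) = 2 * s) :
    ∃ v : RootCoords r s, (∀ j, v.2.2 j ≠ 0) ∧ rootFamily v = m := by
  classical
  -- Conjugation exchanges the two open half planes, so exactly half of the $2s$ non-real members
  -- lie in the upper one; these supply the pairs $(y_j,z_j)$.
  have hneg : m.filter (fun w => w.im < 0) =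
      (m.filter fun w => 0 < w.im).map (starRingEnd ℂ) := by
    conv_lhs => rw [← hm]
    rw [Multiset.filter_map]
    congr 2
    ext w
    simp
  have hsplit : m.filter (fun w => w.im ≠ 0) =
      m.filter (fun w => 0 < w.im) + m.filter (fun w => w.im < 0) := by
    rw [Multiset.filter_add_filter]
    rw [show m.filter (fun a : ℂ => 0 < a.im ∧ a.im < 0) = 0 from
      Multiset.filter_eq_nil.mpr fun a _ h => lt_asymm h.1 h.2, add_zero]
    refine Multiset.filter_congr fun w _ => ?_
    rw [ne_iff_lt_or_gt, or_comm]
  have hall := Multiset.filter_add_not (fun w : ℂ => w.im ≠ 0) m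
  have hpos : Multiset.card (m.filter fun w => 0 < w.im) = s := by
    have := hs
    rw [hsplit, Multiset.card_add, hneg, Multiset.card_map] at this
    omega
  have hreal : Multiset.card (m.filter fun w => ¬ w.im ≠ 0) = r := by
    have := congrArg Multiset.card hall
    rw [Multiset.card_add, hs, hc] at this
    omega
  obtain ⟨f, hf⟩ := exists_fin_map _ hreal
  obtain ⟨g, hg⟩ := exists_fin_map _ hpos
  have hf0 : ∀ j, (f j).im = 0 := fun j => by
    have : f j ∈ m.filter (fun w => ¬ w.im ≠ 0) := by rw [hf]; simp
    simpa using (Multiset.mem_filter.mp this).2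
  have hg0 : ∀ j, 0 < (g j).im := fun j => by
    have : g j ∈ m.filter (fun w => 0 < w.im) := by rw [hg]; simp
    exact (Multiset.mem_filter.mp this).2
  refine ⟨(fun j => (f j).re, fun j => (g j).re, fun j => (g j).im),
    fun j => (hg0 j).ne', ?_⟩
  rw [← hall, hsplit, hneg, hg, hf, add_comm, Multiset.map_map]
  unfold rootFamily
  have h1 : (fun j => (((f j).re : ℝ) : ℂ)) = f := by
    ext j
    exact Complex.ext (by simp) (by simp [hf0])
  have h2 : (fun j => (((g j).re : ℝ) : ℂ) + ((g j).im : ℝ) * Complex.I) = g := by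
    ext j; exact Complex.re_add_im _
  have h3 : (fun j => (((g j).re : ℝ) : ℂ) - ((g j).im : ℝ) * Complex.I) =
      (starRingEnd ℂ) ∘ g := by
    ext j; exact Complex.ext (by simp) (by simp)
  simp only [h1, h2, h3]

/-- The leading coefficient 1 must itself obey the bound $B$; this is where $B\ge1$ enters. -/
lemma image_coeffMap_rootSet {r s : ℕ} {B : ℝ} (hB : 1 ≤ B) :
    coeffMap '' rootSet r s B = coeffSetMonic (r + 2 * s) s B := by
  ext p
  simp only [Set.mem_image, mem_rootSet_iff, coeffSetMonic, coeffSet, Set.mem_ofPred_eq]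
  constructor
  · rintro ⟨v, ⟨h1, h2⟩, rfl⟩
    refine ⟨fun i => ?_, ?_⟩
    · refine Fin.lastCases ?_ (fun j => ?_) i
      · simpa using hB
      · simpa using h1 j
    · rw [toPoly_snoc_coeffMap, HasSignature, aroots_rootPoly]
      exact card_filter_rootFamily h2
  · rintro ⟨h1, h2⟩
    set P := toPoly (Fin.snoc p 1 : Fin (r + 2 * s + 1) → ℝ) with hP
    have hlast : P.coeff (r + 2 * s) = 1 := by
      have := coeff_toPoly (Fin.snoc p 1 : Fin (r + 2 * s + 1) → ℝ) (Fin.last _)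
      simpa using this
    have hdeg : P.natDegree = r + 2 * s :=
      natDegree_eq_of_le_of_coeff_ne_zero (natDegree_toPoly_le _) (by rw [hlast]; exact one_ne_zero)
    have hmon : P.Monic := by rw [Monic, leadingCoeff, hdeg, hlast]
    have hcard : Multiset.card (P.aroots ℂ) = r + 2 * s := by
      rw [aroots_def, ← (IsAlgClosed.splits (P.map (algebraMap ℝ ℂ))).natDegree_eq_card_roots,
        natDegree_map, hdeg]
    obtain ⟨v, hv0, hv⟩ := exists_rootFamily_eq hcard (aroots_map_conj P) h2
    have hPv : rootPoly v = P := by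
      apply map_injective (algebraMap ℝ ℂ) (algebraMap ℝ ℂ).injective
      rw [map_rootPoly_eq_prod, hv, aroots_def]
      exact ((IsAlgClosed.splits (P.map (algebraMap ℝ ℂ))).eq_prod_roots_of_monic
        (hmon.map _)).symm
    have hpv : coeffMap v = p := by
      ext i
      have := coeff_toPoly (Fin.snoc p 1 : Fin (r + 2 * s + 1) → ℝ) i.castSucc
      rw [coeffMap, hPv, hP]
      simpa using this
    refine ⟨v, ⟨fun i => ?_, hv0⟩, hpv⟩
    rw [hpv]
    simpa using h1 i.castSucc

/-! ### The weight as a product of root differences -/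

lemma natDegree_quadFactor (y z : ℝ) : (quadFactor y z).natDegree = 2 := by
  unfold quadFactor; compute_degree!

lemma resultant_quadFactor (y z y' z' : ℝ) :
    (quadFactor y z).resultant (quadFactor y' z') =
      ((y - y') ^ 2 + (z - z') ^ 2) * ((y - y') ^ 2 + (z + z') ^ 2) := by
  have h := resultant_map_map (quadFactor y z) (quadFactor y' z')
    (quadFactor y z).natDegree (quadFactor y' z').natDegree (algebraMap ℝ ℂ)
  rw [natDegree_quadFactor, natDegree_quadFactor] at h
  rw [natDegree_quadFactor, natDegree_quadFactor]
  apply Complex.ofReal_injective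
  refine h.symm.trans ?_
  have hd : ((quadFactor y' z').map (algebraMap ℝ ℂ)).natDegree ≤ 2 :=
    natDegree_map_le.trans (natDegree_quadFactor y' z').le
  have e : (2 : ℕ) = (X - C ((y : ℂ) + z * Complex.I)).natDegree +
      (X - C ((y : ℂ) - z * Complex.I)).natDegree := by
    rw [natDegree_X_sub_C, natDegree_X_sub_C]
  rw [map_quadFactor y z]
  -- The resultant carries its degrees as arguments; the left one must read $1+1$ for
  -- multiplicativity to apply.
  nth_rw 1 [e]
  rw [resultant_mul_left _ _ _ _ hd, natDegree_X_sub_C, natDegree_X_sub_C,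
    resultant_X_sub_C_left _ _ _ hd, resultant_X_sub_C_left _ _ _ hd, map_quadFactor]
  simp only [eval_mul, eval_sub, eval_X, eval_C]
  push_cast
  have hI : Complex.I ^ 2 = -1 := Complex.I_sq
  have hI4 : Complex.I ^ 4 = 1 := Complex.I_pow_four
  ring_nf
  rw [hI, hI4]
  ring

lemma eval_quadFactor (x y z : ℝ) : (quadFactor y z).eval x = (x - y) ^ 2 + z ^ 2 := by
  simp [quadFactor]; ring

lemma norm_mul_norm_of_conj {a b : ℂ} (hre : b.re = a.re) (him : b.im = -a.im) :
    ‖a‖ * ‖b‖ = a.re ^ 2 + a.im ^ 2 := by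
  have : b = (starRingEnd ℂ) a := Complex.ext (by simpa using hre) (by simpa using him)
  rw [this, Complex.norm_conj, Complex.norm_mul_self_eq_normSq, Complex.normSq_apply]
  ring

/-- The product of `‖w i - w j‖` over all ordered pairs of different indices. -/
def pairProd {ι : Type*} [Fintype ι] [DecidableEq ι] (w : ι → ℂ) : ℝ :=
  ∏ i, ∏ j, if i = j then 1 else ‖w i - w j‖

lemma pairProd_comp {ι κ : Type*} [Fintype ι] [DecidableEq ι] [Fintype κ] [DecidableEq κ]
    (w : ι → ℂ) (e : κ ≃ ι) : pairProd (w ∘ e) = pairProd w := by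
  unfold pairProd
  rw [← Equiv.prod_comp e fun i => ∏ j, if i = j then (1 : ℝ) else ‖w i - w j‖]
  refine Finset.prod_congr rfl fun i _ => ?_
  rw [← Equiv.prod_comp e fun j => if e i = j then (1 : ℝ) else ‖w (e i) - w j‖]
  simp

lemma prod_prod_eq_diag_mul {n : ℕ} (f : Fin n → Fin n → ℝ) :
    ∏ i, ∏ j, f i j = (∏ i, f i i) * ∏ i, ∏ j ∈ Finset.Ioi i, f j i * f i j := by
  rw [Finset.prod_prod_Ioi_mul_eq_prod_prod_off_diag f,
    Finset.prod_comm (f := fun i j => f i j), ← Finset.prod_mul_distrib]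
  refine Finset.prod_congr rfl fun i _ => ?_
  rw [← Finset.prod_compl_mul_prod {i}, Finset.prod_singleton, mul_comm]

lemma rootWeight_nonneg {r s : ℕ} (v : RootCoords r s) : 0 ≤ rootWeight v := by
  unfold rootWeight deltaQuad deltaMixed
  simp only [resultant_quadFactor, eval_quadFactor]
  positivity

/-- Sort the ordered pairs of roots by type: real-real gives $\Delta_r^2$, real against pair gives
$\Delta_{r,s}^2$, two distinct pairs give each resultant twice, and a root with its own conjugate
gives $|2z_j|$ twice. Using norms over ordered pairs makes the product independent of signs and of
the numbering. -/
lemma pairProd_rootVec {r s : ℕ} (v : RootCoords r s) :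
    pairProd (rootVec v) = (2 ^ s * rootWeight v) ^ 2 := by
  obtain ⟨x, y, z⟩ := v
  have hxx : ∏ i : Fin r, ∏ j : Fin r, (if i = j then 1 else ‖(x i : ℂ) - x j‖) =
      (∏ i : Fin r, ∏ j ∈ Finset.Ioi i, (x i - x j)) ^ 2 := by
    rw [prod_prod_eq_diag_mul]
    simp only [if_true, Finset.prod_const_one, one_mul]
    rw [← Finset.prod_pow]
    refine Finset.prod_congr rfl fun i _ => ?_
    rw [← Finset.prod_pow]
    refine Finset.prod_congr rfl fun j hj => ?_
    have hij : i ≠ j := (Finset.mem_Ioi.mp hj).ne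
    rw [if_neg hij.symm, if_neg hij, norm_sub_rev, ← sq, ← Complex.ofReal_sub,
      Complex.norm_real, Real.norm_eq_abs, sq_abs]
  have hxz : ∏ i : Fin r, ((∏ j : Fin s, ‖(x i : ℂ) - (y j + z j * Complex.I)‖) *
      ∏ j : Fin s, ‖(x i : ℂ) - (y j - z j * Complex.I)‖) =
      ∏ i : Fin r, ∏ j : Fin s, (quadFactor (y j) (z j)).eval (x i) := by
    refine Finset.prod_congr rfl fun i _ => ?_
    rw [← Finset.prod_mul_distrib]
    refine Finset.prod_congr rfl fun j _ => ?_
    rw [norm_mul_norm_of_conj (by simp) (by simp), eval_quadFactor]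
    simp
  have hzz : (∏ i : Fin s, ((∏ j : Fin s,
        (if i = j then 1 else ‖((y i : ℂ) + z i * Complex.I) - (y j + z j * Complex.I)‖)) *
        ∏ j : Fin s, ‖((y i : ℂ) + z i * Complex.I) - (y j - z j * Complex.I)‖)) *
      (∏ i : Fin s, ((∏ j : Fin s, ‖((y i : ℂ) - z i * Complex.I) - (y j + z j * Complex.I)‖) *
        ∏ j : Fin s,
        (if i = j then 1 else ‖((y i : ℂ) - z i * Complex.I) - (y j - z j * Complex.I)‖))) =
      (2 ^ s * ∏ j, |z j|) ^ 2 * (∏ i : Fin s, ∏ j ∈ Finset.Ioi i,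
        (quadFactor (y i) (z i)).resultant (quadFactor (y j) (z j))) ^ 2 := by
    simp only [← Finset.prod_mul_distrib]
    rw [prod_prod_eq_diag_mul]
    congr 1
    · have h4 : (2 ^ s * ∏ j, |z j|) ^ 2 = ∏ j, (2 * |z j|) ^ 2 := by
        rw [Finset.prod_pow, Finset.prod_mul_distrib]; simp
      rw [h4]
      refine Finset.prod_congr rfl fun i _ => ?_
      simp only [if_true, one_mul, mul_one]
      rw [norm_mul_norm_of_conj (by simp) (by simp; ring), mul_pow, sq_abs]
      simp
      ring
    · rw [← Finset.prod_pow]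
      refine Finset.prod_congr rfl fun i _ => ?_
      rw [← Finset.prod_pow]
      refine Finset.prod_congr rfl fun j hj => ?_
      have hij : i ≠ j := (Finset.mem_Ioi.mp hj).ne
      simp only [if_neg hij, if_neg hij.symm]
      have key : ∀ a b : Fin s,
          ‖((y a : ℂ) + z a * Complex.I) - (y b + z b * Complex.I)‖ *
          ‖((y a : ℂ) + z a * Complex.I) - (y b - z b * Complex.I)‖ *
          (‖((y a : ℂ) - z a * Complex.I) - (y b + z b * Complex.I)‖ *
          ‖((y a : ℂ) - z a * Complex.I) - (y b - z b * Complex.I)‖) =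
          (quadFactor (y a) (z a)).resultant (quadFactor (y b) (z b)) := by
        intro a b
        have h1 := norm_mul_norm_of_conj
          (a := ((y a : ℂ) + z a * Complex.I) - (y b + z b * Complex.I))
          (b := ((y a : ℂ) - z a * Complex.I) - (y b - z b * Complex.I))
          (by simp) (by simp; ring)
        have h2 := norm_mul_norm_of_conj
          (a := ((y a : ℂ) + z a * Complex.I) - (y b - z b * Complex.I))
          (b := ((y a : ℂ) - z a * Complex.I) - (y b + z b * Complex.I))
          (by simp) (by simp; ring)
        have aux : ∀ p q t u m n : ℝ, p * u = m → q * t = n → p * q * (t * u) = m * n := by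
          rintro p q t u _ _ rfl rfl; ring
        rw [aux _ _ _ _ _ _ h1 h2, resultant_quadFactor]
        simp
      rw [key, key, sq, resultant_quadFactor, resultant_quadFactor]
      ring
  unfold pairProd
  have hsymm : ∀ (f : Fin r → ℂ) (g : Fin s → ℂ),
      ∏ i : Fin s, ∏ j : Fin r, ‖g i - f j‖ = ∏ i : Fin r, ∏ j : Fin s, ‖f i - g j‖ := by
    intro f g
    rw [Finset.prod_comm]
    simp only [norm_sub_rev]
  simp only [Fintype.prod_sum_type, rootVec, Sum.elim_inl, Sum.elim_inr, Sum.inl.injEq,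
    Sum.inr.injEq, reduceCtorEq, if_false]
  simp only [Finset.prod_mul_distrib] at hxz hzz ⊢
  rw [hsymm (fun i => (x i : ℂ)) (fun j => (y j : ℂ) + z j * Complex.I),
    hsymm (fun i => (x i : ℂ)) (fun j => (y j : ℂ) - z j * Complex.I), hxx]
  have aux : ∀ m p q a b c d n k t : ℝ, p * q = n → a * b * (c * d) = k →
      m * n ^ 2 * k = t → m * (p * q) * (p * (a * b) * (q * (c * d))) = t := by
    rintro m p q a b c d _ _ _ rfl rfl rfl; ring
  refine aux _ _ _ _ _ _ _ _ _ _ hxz hzz ?_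
  unfold rootWeight deltaReal deltaQuad deltaMixed
  rw [← sq_abs (∏ i : Fin r, ∏ j ∈ Finset.Ioi i, (x i - x j))]
  ring

/-! ### The Jacobian of the coefficient map -/

/-- The root coordinates as a single family of real numbers indexed by `RootIdx r s`. -/
def splitEquiv (r s : ℕ) : (RootIdx r s → ℝ) ≃ᵐ RootCoords r s :=
  (MeasurableEquiv.sumPiEquivProdPi fun _ => ℝ).trans
    (MeasurableEquiv.prodCongr (MeasurableEquiv.refl _)
      (MeasurableEquiv.sumPiEquivProdPi fun _ => ℝ))

lemma splitEquiv_apply {r s : ℕ} (u : RootIdx r s → ℝ) :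
    splitEquiv r s u = (fun j => u (Sum.inl j), fun j => u (Sum.inr (Sum.inl j)),
      fun j => u (Sum.inr (Sum.inr j))) := rfl

lemma measurePreserving_splitEquiv (r s : ℕ) :
    MeasurePreserving (splitEquiv r s) volume volume :=
  (volume_measurePreserving_sumPiEquivProdPi fun _ : RootIdx r s => ℝ).trans
    ((MeasurePreserving.id volume).prod
      (volume_measurePreserving_sumPiEquivProdPi fun _ : Fin s ⊕ Fin s => ℝ))

/-- A numbering of the roots. -/
def idxEquiv (r s : ℕ) : RootIdx r s ≃ Fin (r + 2 * s) :=
  Fintype.equivFinOfCardEq (by simp; ring)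

/-- The `k`-th root as a linear function of the root coordinates. -/
def rootLin {r s : ℕ} (k : RootIdx r s) : (RootIdx r s → ℝ) →L[ℝ] ℂ :=
  match k with
  | .inl j => Complex.ofRealCLM.comp (ContinuousLinearMap.proj (.inl j))
  | .inr (.inl j) => Complex.ofRealCLM.comp (ContinuousLinearMap.proj (.inr (.inl j))) +
      Complex.I • Complex.ofRealCLM.comp (ContinuousLinearMap.proj (.inr (.inr j)))
  | .inr (.inr j) => Complex.ofRealCLM.comp (ContinuousLinearMap.proj (.inr (.inl j))) -
      Complex.I • Complex.ofRealCLM.comp (ContinuousLinearMap.proj (.inr (.inr j)))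

lemma rootLin_apply {r s : ℕ} (k : RootIdx r s) (u : RootIdx r s → ℝ) :
    rootLin k u = rootVec (splitEquiv r s u) k := by
  rcases k with j | j | j <;> simp [rootLin, rootVec, splitEquiv_apply, mul_comm]

/-- The coefficient map between spaces of families indexed by `RootIdx r s`. -/
def coeffMapIdx {r s : ℕ} (u : RootIdx r s → ℝ) : RootIdx r s → ℝ :=
  fun i => coeffMap (splitEquiv r s u) (idxEquiv r s i)

/-- Exhibits each coefficient as a polynomial in the roots, which makes continuity and
differentiability evident. -/
lemma coeffMap_eq_re {r s : ℕ} (v : RootCoords r s) (i : Fin (r + 2 * s)) :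
    coeffMap v i = ((-1) ^ (r + 2 * s - (i : ℕ)) *
      ∑ t ∈ Finset.powersetCard (r + 2 * s - i) Finset.univ, ∏ k ∈ t, rootVec v k : ℂ).re := by
  rw [← Finset.esymm_map_val, ← rootFamily_eq_map, ← coeffMap_eq_esymm, Complex.ofReal_re]

lemma differentiable_coeffMapIdx (r s : ℕ) :
    Differentiable ℝ (coeffMapIdx : (RootIdx r s → ℝ) → RootIdx r s → ℝ) := by
  rw [differentiable_pi]
  intro i
  unfold coeffMapIdx
  simp only [coeffMap_eq_re, ← rootLin_apply]
  refine Complex.reCLM.differentiable.comp (Differentiable.const_mul ?_ _)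
  refine Differentiable.fun_sum fun t _ => ?_
  exact fun u => (HasFDerivAt.finsetProd fun k _ => (rootLin k).hasFDerivAt).differentiableAt

lemma sum_coeffMapIdx_mul_pow {r s : ℕ} (u : RootIdx r s → ℝ) (w : ℂ) :
    (∑ i, (coeffMapIdx u i : ℂ) * w ^ (idxEquiv r s i : ℕ)) + w ^ (r + 2 * s) =
      ∏ k, (w - rootLin k u) := by
  have h := congrArg (eval w) (map_rootPoly (splitEquiv r s u))
  rw [eval_eq_sum_range, natDegree_map, natDegree_rootPoly, Finset.sum_range_succ,
    Finset.sum_range, eval_prod] at h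
  simp only [eval_sub, eval_X, eval_C, ← rootLin_apply, coeff_map] at h
  have hm := (monic_rootPoly (splitEquiv r s u)).coeff_natDegree
  rw [natDegree_rootPoly] at hm
  rw [hm, map_one, one_mul] at h
  rw [← h, ← (idxEquiv r s).sum_comp]
  rfl

/-- The matrix of the roots as linear functions of the root coordinates. -/
def rootMatrix (r s : ℕ) : Matrix (RootIdx r s) (RootIdx r s) ℂ :=
  Matrix.of fun i l => rootLin i (Pi.single l 1)

/-- Each conjugate pair contributes a block with rows $(1,i)$ and $(1,-i)$, of determinant $-2i$. -/
lemma norm_det_rootMatrix (r s : ℕ) : ‖(rootMatrix r s).det‖ = 2 ^ s := by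
  have h : rootMatrix r s = Matrix.fromBlocks 1 0 0
      (Matrix.fromBlocks 1 (Complex.I • 1) 1 (-(Complex.I • 1))) := by
    ext i l
    rcases i with i | i | i <;> rcases l with l | l | l <;>
      simp [rootMatrix, rootLin, Matrix.one_apply, Pi.single_apply, apply_ite Complex.ofReal]
  rw [h, Matrix.det_fromBlocks_one₁₁, Matrix.zero_mul, sub_zero, Matrix.det_fromBlocks_one₁₁,
    Matrix.one_mul, ← neg_add', ← two_smul ℂ, smul_smul, ← neg_smul, Matrix.det_smul]
  simp

/-- The Vandermonde matrix of the roots. -/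
def rootVandermonde {r s : ℕ} (v : RootCoords r s) : Matrix (RootIdx r s) (RootIdx r s) ℂ :=
  Matrix.of fun i k => rootVec v i ^ (idxEquiv r s k : ℕ)

lemma norm_det_vandermonde_sq {n : ℕ} (w : Fin n → ℂ) :
    ‖(Matrix.vandermonde w).det‖ ^ 2 = pairProd w := by
  rw [Matrix.det_vandermonde, pairProd, prod_prod_eq_diag_mul, norm_prod, ← Finset.prod_pow]
  simp only [if_true, Finset.prod_const_one, one_mul]
  refine Finset.prod_congr rfl fun i _ => ?_
  rw [norm_prod, ← Finset.prod_pow]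
  refine Finset.prod_congr rfl fun j hj => ?_
  have hij : i ≠ j := (Finset.mem_Ioi.mp hj).ne
  rw [if_neg hij, if_neg hij.symm, norm_sub_rev (w i), sq]

lemma norm_det_rootVandermonde {r s : ℕ} (v : RootCoords r s) :
    ‖(rootVandermonde v).det‖ = 2 ^ s * rootWeight v := by
  have h : rootVandermonde v = (Matrix.vandermonde (rootVec v ∘ (idxEquiv r s).symm)).submatrix
      (idxEquiv r s) (idxEquiv r s) := by
    ext i k; simp [rootVandermonde, Matrix.vandermonde]
  have h2 : ‖(rootVandermonde v).det‖ ^ 2 = (2 ^ s * rootWeight v) ^ 2 := by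
    rw [h, Matrix.det_submatrix_equiv_self, norm_det_vandermonde_sq, pairProd_comp,
      pairProd_rootVec]
  exact (pow_left_inj₀ (norm_nonneg _)
    (mul_nonneg (by positivity) (rootWeight_nonneg v)) two_ne_zero).mp h2

lemma norm_prod_erase_eq_pairProd {ι : Type*} [Fintype ι] [DecidableEq ι] (w : ι → ℂ) :
    ‖∏ i, ∏ j ∈ Finset.univ.erase i, (w i - w j)‖ = pairProd w := by
  unfold pairProd
  rw [norm_prod]
  refine Finset.prod_congr rfl fun i _ => ?_
  rw [norm_prod, ← Finset.mul_prod_erase Finset.univ _ (Finset.mem_univ i), if_pos rfl, one_mul]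
  refine Finset.prod_congr rfl fun j hj => ?_
  rw [if_neg (Finset.ne_of_mem_erase hj).symm]

/-- Row $i$ is the derivative at $u$ of the two sides of `sum_coeffMapIdx_mul_pow`, evaluated at the
$i$-th root. -/
lemma rootVandermonde_mul_jacobian {r s : ℕ} (u : RootIdx r s → ℝ) :
    rootVandermonde (splitEquiv r s u) *
        (LinearMap.toMatrix' (fderiv ℝ coeffMapIdx u : (RootIdx r s → ℝ) →ₗ[ℝ] _)).map
          (algebraMap ℝ ℂ) =
      Matrix.diagonal (fun i => -∏ j ∈ Finset.univ.erase i,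
          (rootVec (splitEquiv r s u) i - rootVec (splitEquiv r s u) j)) *
        rootMatrix r s := by
  have hF := (differentiable_coeffMapIdx r s u).hasFDerivAt
  ext i l
  -- $w$ is frozen at the base point: it does not vary with $u'$ below, and the $i$-th factor
  -- $w-w_i(u')$ vanishes at $u'=u$.
  set w := rootVec (splitEquiv r s u) i with hw
  have h1 : HasFDerivAt (fun u' : RootIdx r s → ℝ =>
      (∑ k, (coeffMapIdx u' k : ℂ) * w ^ (idxEquiv r s k : ℕ)) + w ^ (r + 2 * s))
      (∑ k, w ^ (idxEquiv r s k : ℕ) • Complex.ofRealCLM.comp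
        ((ContinuousLinearMap.proj k).comp (fderiv ℝ coeffMapIdx u))) u := by
    refine HasFDerivAt.add_const _ (HasFDerivAt.fun_sum fun k _ => ?_)
    refine HasFDerivAt.mul_const ?_ _
    exact Complex.ofRealCLM.hasFDerivAt.comp u (hasFDerivAt_pi'.mp hF k)
  have h2 : HasFDerivAt (fun u' : RootIdx r s → ℝ => ∏ k, (w - rootLin k u'))
      (∑ k, (∏ j ∈ Finset.univ.erase k, (w - rootLin j u)) • (-rootLin k)) u :=
    HasFDerivAt.finsetProd fun k _ => (rootLin k).hasFDerivAt.const_sub w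
  simp only [sum_coeffMapIdx_mul_pow] at h1
  have h3 := DFunLike.congr_fun (h1.unique h2) (Pi.single l 1)
  rw [Matrix.mul_apply, Matrix.diagonal_mul]
  have h4 : (∑ k, (∏ j ∈ Finset.univ.erase k, (w - rootLin j u)) • (-rootLin k))
      (Pi.single l 1) =
      (∏ j ∈ Finset.univ.erase i, (w - rootLin j u)) * (-rootLin i (Pi.single l 1)) := by
    rw [sum_apply, Finset.sum_eq_single i]
    · rfl
    · intro k _ hk
      rw [Finset.prod_eq_zero (Finset.mem_erase.mpr ⟨hk.symm, Finset.mem_univ i⟩)]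
      · exact zero_mul (-rootLin k (Pi.single l 1))
      · rw [rootLin_apply, hw, sub_self]
    · simp
  rw [h4, sum_apply] at h3
  simp only [rootLin_apply] at h3
  simp only [rootMatrix, rootVandermonde, Matrix.of_apply, Matrix.map_apply,
    LinearMap.toMatrix'_apply, ← hw, rootLin_apply]
  rw [neg_mul, ← mul_neg]
  exact h3

/-- Norms of determinants give $2^sW\,|\det J|=(2^sW)^2\,2^s$; nonvanishing of $W$ allows the
cancellation. -/
lemma abs_det_fderiv_coeffMapIdx {r s : ℕ} (u : RootIdx r s → ℝ)
    (hu : rootWeight (splitEquiv r s u) ≠ 0) :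
    |(fderiv ℝ coeffMapIdx u).det| = 4 ^ s * rootWeight (splitEquiv r s u) := by
  have h := congrArg (fun A => ‖Matrix.det A‖) (rootVandermonde_mul_jacobian u)
  simp only [Matrix.det_mul, norm_mul, norm_det_rootMatrix, norm_det_rootVandermonde,
    Matrix.det_diagonal, norm_prod, norm_neg] at h
  rw [← RingHom.mapMatrix_apply, ← RingHom.map_det, LinearMap.det_toMatrix',
    Complex.coe_algebraMap, Complex.norm_real, Real.norm_eq_abs] at h
  simp only [← norm_prod] at h
  rw [norm_prod_erase_eq_pairProd, pairProd_rootVec] at h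
  have h0 : (2 : ℝ) ^ s * rootWeight (splitEquiv r s u) ≠ 0 := mul_ne_zero (by positivity) hu
  have h4 : (4 : ℝ) ^ s = 2 ^ s * 2 ^ s := by rw [← mul_pow]; norm_num
  apply mul_left_cancel₀ h0
  rw [h4]
  linear_combination h

/-! ### Symmetries and a fundamental domain -/

/-- The root coordinates with increasing real parts and positive imaginary parts. -/
def orderedRoots (r s : ℕ) : Set (RootCoords r s) :=
  {v | StrictMono v.1 ∧ StrictMono v.2.1 ∧ ∀ j, 0 < v.2.2 j}

/-- The permutations of the real roots and of the conjugate pairs, with the choice of the pairs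
whose two members are interchanged. -/
abbrev RootSymm (r s : ℕ) : Type :=
  Equiv.Perm (Fin r) × Equiv.Perm (Fin s) × (Fin s → Bool)

/-- The action of a symmetry on root coordinates. -/
def rootAct {r s : ℕ} (g : RootSymm r s) (v : RootCoords r s) : RootCoords r s :=
  (fun j => v.1 (g.1 j), fun j => v.2.1 (g.2.1 j),
    fun j => if g.2.2 j then v.2.2 (g.2.1 j) else -v.2.2 (g.2.1 j))

lemma card_rootSymm (r s : ℕ) :
    Fintype.card (RootSymm r s) = r.factorial * (s.factorial * 2 ^ s) := by
  simp [Fintype.card_perm]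

lemma measurePreserving_comp_perm {n : ℕ} (σ : Equiv.Perm (Fin n)) :
    MeasurePreserving (fun (x : Fin n → ℝ) (j : Fin n) => x (σ j)) volume volume := by
  convert volume_measurePreserving_piCongrLeft (fun _ : Fin n => ℝ) σ.symm using 1
  ext x j
  have := MeasurableEquiv.piCongrLeft_apply_apply (β := fun _ : Fin n => ℝ) (e := σ.symm) x (σ j)
  rw [← this, Equiv.symm_apply_apply]

lemma measurePreserving_rootAct {r s : ℕ} (g : RootSymm r s) :
    MeasurePreserving (rootAct g) volume volume := by
  have hz : MeasurePreserving
      (fun (z : Fin s → ℝ) (j : Fin s) => if g.2.2 j then z j else -z j) volume volume := by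
    refine volume_preserving_pi (f := fun j (t : ℝ) => if g.2.2 j then t else -t) fun j => ?_
    cases g.2.2 j
    · simpa using Measure.measurePreserving_neg (volume : Measure ℝ)
    · simpa using! MeasurePreserving.id (volume : Measure ℝ)
  exact (measurePreserving_comp_perm g.1).prod ((measurePreserving_comp_perm g.2.1).prod
    (hz.comp (measurePreserving_comp_perm g.2.1)))

lemma exists_rootVec_rootAct {r s : ℕ} (g : RootSymm r s) (v : RootCoords r s) :
    ∃ e : Equiv.Perm (RootIdx r s), rootVec (rootAct g v) = rootVec v ∘ e := by
  let f : RootIdx r s → RootIdx r s := Sum.elim (fun j => .inl (g.1 j))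
    (Sum.elim
      (fun j => if g.2.2 j then .inr (.inl (g.2.1 j)) else .inr (.inr (g.2.1 j)))
      (fun j => if g.2.2 j then .inr (.inr (g.2.1 j)) else .inr (.inl (g.2.1 j))))
  have hf : Function.Injective f := by
    rintro (i | i | i) (j | j | j) h <;> simp only [f, Sum.elim_inl, Sum.elim_inr] at h <;>
      (try split_ifs at h) <;> simp_all
  refine ⟨Equiv.ofBijective f (Finite.injective_iff_bijective.mp hf), ?_⟩
  ext k
  rcases k with j | j | j <;> simp only [Function.comp, Equiv.ofBijective_apply, f, rootVec,
    rootAct, Sum.elim_inl, Sum.elim_inr] <;> split_ifs <;> simp [sub_eq_add_neg]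

lemma rootFamily_rootAct {r s : ℕ} (g : RootSymm r s) (v : RootCoords r s) :
    rootFamily (rootAct g v) = rootFamily v := by
  obtain ⟨e, he⟩ := exists_rootVec_rootAct g v
  rw [rootFamily_eq_map, rootFamily_eq_map, he, ← Multiset.map_map,
    Multiset.map_univ_val_equiv]

lemma coeffMap_rootAct {r s : ℕ} (g : RootSymm r s) (v : RootCoords r s) :
    coeffMap (rootAct g v) = coeffMap v :=
  coeffMap_eq_iff.mpr (rootFamily_rootAct g v)

lemma rootWeight_rootAct {r s : ℕ} (g : RootSymm r s) (v : RootCoords r s) :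
    rootWeight (rootAct g v) = rootWeight v := by
  obtain ⟨e, he⟩ := exists_rootVec_rootAct g v
  have h := pairProd_rootVec (rootAct g v)
  rw [he, pairProd_comp, pairProd_rootVec] at h
  have h2 := (pow_left_inj₀ (mul_nonneg (by positivity) (rootWeight_nonneg v))
    (mul_nonneg (by positivity) (rootWeight_nonneg _)) two_ne_zero).mp h
  exact (mul_left_cancel₀ (by positivity) h2).symm

lemma rootAct_mem_rootSet_iff {r s : ℕ} {B : ℝ} (g : RootSymm r s) (v : RootCoords r s) :
    rootAct g v ∈ rootSet r s B ↔ v ∈ rootSet r s B := by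
  rw [mem_rootSet_iff, mem_rootSet_iff, coeffMap_rootAct]
  refine and_congr_right fun _ => ⟨fun h j => ?_, fun h j => ?_⟩
  · have := h (g.2.1.symm j)
    simp only [rootAct, Equiv.apply_symm_apply] at this
    split_ifs at this
    · exact this
    · exact neg_ne_zero.mp this
  · simp only [rootAct]
    split_ifs
    · exact h _
    · exact neg_ne_zero.mpr (h _)

lemma strictMono_comp_unique {n : ℕ} {x : Fin n → ℝ} (hx : Function.Injective x)
    {σ τ : Equiv.Perm (Fin n)} (hσ : StrictMono fun j => x (σ j))
    (hτ : StrictMono fun j => x (τ j)) : σ = τ := by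
  have h := Tuple.unique_monotone (f := x) (σ := σ) (τ := τ) hσ.monotone hτ.monotone
  ext j
  exact congrArg _ (hx (congrFun h j))

/-- Sorting fixes both permutations because the entries are distinct, and the signs of the $z_j$
then fix the swaps. -/
lemma existsUnique_rootAct_mem {r s : ℕ} {v : RootCoords r s} (hx : Function.Injective v.1)
    (hy : Function.Injective v.2.1) (hz : ∀ j, v.2.2 j ≠ 0) :
    ∃! g : RootSymm r s, rootAct g v ∈ orderedRoots r s := by
  refine ⟨(Tuple.sort v.1, Tuple.sort v.2.1,
    fun j => decide (0 < v.2.2 (Tuple.sort v.2.1 j))), ⟨?_, ?_, ?_⟩, ?_⟩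
  · exact (Tuple.monotone_sort v.1).strictMono_of_injective (hx.comp (Equiv.injective _))
  · exact (Tuple.monotone_sort v.2.1).strictMono_of_injective (hy.comp (Equiv.injective _))
  · intro j
    simp only [rootAct, decide_eq_true_eq]
    split_ifs with h
    · exact h
    · exact neg_pos.mpr (lt_of_le_of_ne (not_lt.mp h) (hz _))
  · rintro ⟨σ, τ, ε⟩ ⟨h1, h2, h3⟩
    have hσ : σ = Tuple.sort v.1 := strictMono_comp_unique hx h1
      ((Tuple.monotone_sort v.1).strictMono_of_injective (hx.comp (Equiv.injective _)))
    have hτ : τ = Tuple.sort v.2.1 := strictMono_comp_unique hy h2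
      ((Tuple.monotone_sort v.2.1).strictMono_of_injective (hy.comp (Equiv.injective _)))
    subst hσ hτ
    have hε : ε = fun j => decide (0 < v.2.2 (Tuple.sort v.2.1 j)) := by
      ext j
      have := h3 j
      simp only [rootAct] at this
      cases hj : ε j
      · simp only [hj] at this
        simpa using this.le
      · simp only [hj] at this
        simpa using this
    rw [hε]

/-! ### Null sets, measurability and unfolding of the integral -/

lemma ae_injective (n : ℕ) : ∀ᵐ x : Fin n → ℝ, Function.Injective x := by
  have h : ∀ i j : Fin n, i ≠ j → ∀ᵐ x : Fin n → ℝ, x i ≠ x j := by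
    intro i j hij
    let L : (Fin n → ℝ) →ₗ[ℝ] ℝ := 
      LinearMap.proj (R := ℝ) (φ := fun _ => ℝ) i - LinearMap.proj (R := ℝ) (φ := fun _ => ℝ) j
    have hL : LinearMap.ker L ≠ ⊤ := by
      rw [Ne, LinearMap.ker_eq_top]
      intro h0
      have := LinearMap.congr_fun h0 (Pi.single i 1)
      simp [L, hij.symm] at this
    have := Measure.addHaar_submodule (volume : Measure (Fin n → ℝ)) (LinearMap.ker L) hL
    rw [ae_iff]
    convert this using 2
    ext x
    simp [L, sub_eq_zero]
  have h2 : ∀ᵐ x : Fin n → ℝ, ∀ i j : Fin n, i ≠ j → x i ≠ x j := by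
    simp only [ae_all_iff]
    exact h
  filter_upwards [h2] with x hx i j hij
  by_contra hne
  exact hx i j hne hij

lemma ae_injective_rootCoords (r s : ℕ) :
    ∀ᵐ v : RootCoords r s, Function.Injective v.1 ∧ Function.Injective v.2.1 := by
  have h1 : ∀ᵐ v : RootCoords r s, Function.Injective v.1 :=
    Measure.quasiMeasurePreserving_fst.ae (ae_injective r)
  have h2 : ∀ᵐ v : RootCoords r s, Function.Injective v.2.1 :=
    (Measure.quasiMeasurePreserving_fst.comp Measure.quasiMeasurePreserving_snd).ae
      (ae_injective s)
  exact h1.and h2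

lemma continuous_rootVec {r s : ℕ} (k : RootIdx r s) :
    Continuous fun v : RootCoords r s => rootVec v k := by
  rcases k with j | j | j <;> simp only [rootVec, Sum.elim_inl, Sum.elim_inr] <;> fun_prop

lemma continuous_coeffMap (r s : ℕ) :
    Continuous (coeffMap : RootCoords r s → Fin (r + 2 * s) → ℝ) := by
  refine continuous_pi fun i => ?_
  simp only [coeffMap_eq_re]
  have := @continuous_rootVec r s
  fun_prop

lemma continuous_rootWeight (r s : ℕ) :
    Continuous (rootWeight : RootCoords r s → ℝ) := by
  unfold rootWeight deltaReal deltaQuad deltaMixed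
  simp only [resultant_quadFactor, eval_quadFactor]
  fun_prop

lemma rootSet_eq_inter (r s : ℕ) (B : ℝ) :
    rootSet r s B = (⋂ i, {v | |coeffMap v i| ≤ B}) ∩ ⋂ j, {v | v.2.2 j ≠ 0} := by
  ext v
  simp [mem_rootSet_iff]

lemma isClosed_coeff_le (r s : ℕ) (B : ℝ) :
    IsClosed (⋂ i, {v : RootCoords r s | |coeffMap v i| ≤ B}) :=
  isClosed_iInter fun i => isClosed_le
    (((continuous_apply i).comp (continuous_coeffMap r s)).abs) continuous_const

lemma isOpen_imag_ne_zero (r s : ℕ) :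
    IsOpen (⋂ j, {v : RootCoords r s | v.2.2 j ≠ 0}) :=
  isOpen_iInter_of_finite fun j => isOpen_ne_fun (by fun_prop) continuous_const

lemma measurableSet_rootSet (r s : ℕ) (B : ℝ) : MeasurableSet (rootSet r s B) := by
  rw [rootSet_eq_inter]
  exact (isClosed_coeff_le r s B).measurableSet.inter (isOpen_imag_ne_zero r s).measurableSet

lemma measurableSet_orderedRoots (r s : ℕ) : MeasurableSet (orderedRoots r s) := by
  have h : orderedRoots r s =
      (⋂ i, ⋂ j, ⋂ _ : i < j, {v | v.1 i < v.1 j}) ∩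
      ((⋂ i, ⋂ j, ⋂ _ : i < j, {v | v.2.1 i < v.2.1 j}) ∩ ⋂ j, {v | 0 < v.2.2 j}) := by
    ext v
    simp [orderedRoots, StrictMono]
  rw [h]
  refine (MeasurableSet.iInter fun i => MeasurableSet.iInter fun j => MeasurableSet.iInter
    fun _ => measurableSet_lt (by fun_prop) (by fun_prop)).inter
    ((MeasurableSet.iInter fun i => MeasurableSet.iInter fun j => MeasurableSet.iInter
    fun _ => measurableSet_lt (by fun_prop) (by fun_prop)).inter
    (MeasurableSet.iInter fun j => measurableSet_lt (by fun_prop) (by fun_prop)))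

/-- The integrand is invariant, so almost everywhere it is the sum over the group of the translates
of its restriction to `orderedRoots`; all these have the same integral. -/
lemma lintegral_rootSet_eq (r s : ℕ) (B : ℝ) :
    ∫⁻ v in rootSet r s B, ENNReal.ofReal (rootWeight v) =
      (r.factorial * (s.factorial * 2 ^ s) : ℕ) *
        ∫⁻ v in rootSet r s B ∩ orderedRoots r s, ENNReal.ofReal (rootWeight v) := by
  classical
  set f : RootCoords r s → ENNReal :=
    (rootSet r s B).indicator fun v => ENNReal.ofReal (rootWeight v) with hf
  have hfact : ∀ g v, f (rootAct g v) = f v := by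
    intro g v
    simp only [hf, Set.indicator, rootAct_mem_rootSet_iff, rootWeight_rootAct]
  have hfm : Measurable f :=
    ((continuous_rootWeight r s).measurable.ennreal_ofReal).indicator
      (measurableSet_rootSet r s B)
  have hfD : Measurable ((orderedRoots r s).indicator f) :=
    hfm.indicator (measurableSet_orderedRoots r s)
  have hsum : f =ᵐ[volume] fun v => ∑ g, (orderedRoots r s).indicator f (rootAct g v) := by
    filter_upwards [ae_injective_rootCoords r s] with v hv
    by_cases hvH : v ∈ rootSet r s B
    · obtain ⟨g, hg, huniq⟩ := existsUnique_rootAct_mem hv.1 hv.2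
        ((mem_rootSet_iff v).mp hvH).2
      rw [Finset.sum_eq_single g]
      · rw [Set.indicator_of_mem hg, hfact]
      · intro g' _ hne
        exact Set.indicator_of_notMem (fun h => hne (huniq g' h)) _
      · simp
    · have h0 : f v = 0 := Set.indicator_of_notMem hvH _
      rw [h0]
      refine (Finset.sum_eq_zero fun g _ => ?_).symm
      rw [Set.indicator_apply, hfact, h0, ite_self]
  rw [← lintegral_indicator (measurableSet_rootSet r s B), ← hf, lintegral_congr_ae hsum,
    lintegral_finsetSum (f := fun g v => (orderedRoots r s).indicator f (rootAct g v)) _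
      fun g _ => hfD.comp (measurePreserving_rootAct g).measurable]
  have hg : ∀ g : RootSymm r s, ∫⁻ v, (orderedRoots r s).indicator f (rootAct g v) =
      ∫⁻ v in rootSet r s B ∩ orderedRoots r s, ENNReal.ofReal (rootWeight v) := by
    intro g
    rw [(measurePreserving_rootAct g).lintegral_comp hfD, hf, Set.indicator_indicator,
      Set.inter_comm, lintegral_indicator
        ((measurableSet_rootSet r s B).inter (measurableSet_orderedRoots r s))]
  simp only [hg]
  rw [Finset.sum_const, Finset.card_univ, card_rootSymm, nsmul_eq_mul]

/-! ### Injectivity and nonvanishing on ordered roots -/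

lemma mem_rootFamily_iff {r s : ℕ} (v : RootCoords r s) (w : ℂ) :
    w ∈ rootFamily v ↔ (∃ j, (v.1 j : ℂ) = w) ∨
      (∃ j, (v.2.1 j : ℂ) + v.2.2 j * Complex.I = w) ∨
      (∃ j, (v.2.1 j : ℂ) - v.2.2 j * Complex.I = w) := by
  simp [rootFamily]

lemma range_fst_eq {r s : ℕ} {v : RootCoords r s} (hz : ∀ j, 0 < v.2.2 j) :
    Set.range v.1 = {t : ℝ | (t : ℂ) ∈ rootFamily v} := by
  ext t
  rw [Set.mem_ofPred_eq, mem_rootFamily_iff]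
  constructor
  · rintro ⟨j, rfl⟩
    exact Or.inl ⟨j, rfl⟩
  · rintro (⟨j, h⟩ | ⟨j, h⟩ | ⟨j, h⟩)
    · exact ⟨j, by exact_mod_cast h⟩
    · have := congrArg Complex.im h
      exact absurd (by simpa using this) (hz j).ne'
    · have := congrArg Complex.im h
      exact absurd (by simpa using this) (hz j).ne'

lemma range_pair_eq {r s : ℕ} {v : RootCoords r s} (hz : ∀ j, 0 < v.2.2 j) :
    Set.range (fun j => ((v.2.1 j : ℂ) + v.2.2 j * Complex.I)) =
      {w | w ∈ rootFamily v ∧ 0 < w.im} := by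
  ext w
  rw [Set.mem_ofPred_eq, mem_rootFamily_iff]
  constructor
  · rintro ⟨j, rfl⟩
    exact ⟨Or.inr (Or.inl ⟨j, rfl⟩), by simpa using hz j⟩
  · rintro ⟨⟨j, rfl⟩ | ⟨j, rfl⟩ | ⟨j, rfl⟩, h⟩
    · simp at h
    · exact ⟨j, rfl⟩
    · exact absurd (by simpa using h) (hz j).not_gt

/-- The root multiset determines the set of real roots and the set of roots in the upper half plane;
a strictly increasing family is determined by its range. -/
lemma injOn_coeffMap (r s : ℕ) :
    Set.InjOn (coeffMap : RootCoords r s → _) (orderedRoots r s) := by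
  rintro v ⟨hx, hy, hz⟩ v' ⟨hx', hy', hz'⟩ h
  have hfam := coeffMap_eq_iff.mp h
  have h1 : v.1 = v'.1 := by
    rw [← hx.range_inj hx', range_fst_eq hz, range_fst_eq hz', hfam]
  have hpair : Set.range (fun j => ((v.2.1 j : ℂ) + v.2.2 j * Complex.I)) =
      Set.range (fun j => ((v'.2.1 j : ℂ) + v'.2.2 j * Complex.I)) := by
    rw [range_pair_eq hz, range_pair_eq hz', hfam]
  have h2 : v.2.1 = v'.2.1 := by
    rw [← hy.range_inj hy']
    have := congrArg (Set.image Complex.re) hpair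
    rw [← Set.range_comp, ← Set.range_comp] at this
    simpa [Function.comp_def] using this
  have h3 : v.2.2 = v'.2.2 := by
    ext j
    obtain ⟨k, hk⟩ : ((v.2.1 j : ℂ) + v.2.2 j * Complex.I) ∈
        Set.range (fun j => ((v'.2.1 j : ℂ) + v'.2.2 j * Complex.I)) := hpair ▸ ⟨j, rfl⟩
    have hre := congrArg Complex.re hk
    have him := congrArg Complex.im hk
    simp only [Complex.add_re, Complex.ofReal_re, Complex.mul_re, Complex.I_re, mul_zero,
      Complex.ofReal_im, Complex.I_im, mul_one, sub_self, add_zero, h2] at hre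
    obtain rfl := hy'.injective hre
    simpa using him.symm
  exact Prod.ext h1 (Prod.ext h2 h3)

lemma rootWeight_ne_zero {r s : ℕ} {v : RootCoords r s} (hv : v ∈ orderedRoots r s) :
    rootWeight v ≠ 0 := by
  obtain ⟨hx, hy, hz⟩ := hv
  unfold rootWeight deltaReal deltaQuad deltaMixed
  simp only [resultant_quadFactor, eval_quadFactor]
  refine mul_ne_zero (mul_ne_zero (mul_ne_zero ?_ ?_) ?_) ?_
  · rw [abs_ne_zero]
    refine Finset.prod_ne_zero_iff.mpr fun i _ => Finset.prod_ne_zero_iff.mpr fun j hj => ?_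
    exact sub_ne_zero.mpr (hx (Finset.mem_Ioi.mp hj)).ne
  · refine Finset.prod_ne_zero_iff.mpr fun i _ => Finset.prod_ne_zero_iff.mpr fun j hj => ?_
    have : v.2.1 i - v.2.1 j ≠ 0 := sub_ne_zero.mpr (hy (Finset.mem_Ioi.mp hj)).ne
    positivity
  · refine Finset.prod_ne_zero_iff.mpr fun i _ => Finset.prod_ne_zero_iff.mpr fun j _ => ?_
    have := hz j
    positivity
  · exact Finset.prod_ne_zero_iff.mpr fun j _ => abs_ne_zero.mpr (hz j).ne'

/-! ### Change of variables and the monic volume -/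

/-- Relabelling of the coefficients. -/
def relabel (r s : ℕ) : (RootIdx r s → ℝ) ≃ᵐ (Fin (r + 2 * s) → ℝ) :=
  MeasurableEquiv.piCongrLeft (fun _ => ℝ) (idxEquiv r s)

lemma measurePreserving_relabel (r s : ℕ) : MeasurePreserving (relabel r s) volume volume :=
  volume_measurePreserving_piCongrLeft (fun _ => ℝ) (idxEquiv r s)

lemma relabel_coeffMapIdx {r s : ℕ} (u : RootIdx r s → ℝ) :
    relabel r s (coeffMapIdx u) = coeffMap (splitEquiv r s u) := by
  ext i
  obtain ⟨k, rfl⟩ := (idxEquiv r s).surjective i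
  exact MeasurableEquiv.piCongrLeft_apply_apply (β := fun _ => ℝ) (idxEquiv r s) _ k

lemma image_coeffMap_eq {r s : ℕ} (A : Set (RootCoords r s)) :
    coeffMap '' A = relabel r s '' (coeffMapIdx '' (splitEquiv r s ⁻¹' A)) := by
  rw [Set.image_image]
  simp only [relabel_coeffMapIdx]
  rw [← Set.image_image coeffMap (splitEquiv r s), Set.image_preimage_eq _
    (splitEquiv r s).surjective]

lemma volume_image_relabel {r s : ℕ} (A : Set (RootIdx r s → ℝ)) :
    volume (relabel r s '' A) = volume A := by
  rw [← (measurePreserving_relabel r s).measure_preimage_equiv,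
    Set.preimage_image_eq _ (relabel r s).injective]

lemma volume_image_coeffMap_of_null {r s : ℕ} {A : Set (RootCoords r s)} (hA : volume A = 0) :
    volume (coeffMap '' A) = 0 := by
  rw [image_coeffMap_eq, volume_image_relabel]
  refine addHaar_image_eq_zero_of_differentiableOn_of_addHaar_eq_zero _
    (differentiable_coeffMapIdx r s).differentiableOn ?_
  rw [(measurePreserving_splitEquiv r s).measure_preimage_equiv, hA]

lemma volume_image_coeffMap_of_ordered {r s : ℕ} {A : Set (RootCoords r s)}
    (hA : MeasurableSet A) (hAo : A ⊆ orderedRoots r s) :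
    volume (coeffMap '' A) = 4 ^ s * ∫⁻ v in A, ENNReal.ofReal (rootWeight v) := by
  have hwm : Measurable fun v : RootCoords r s => ENNReal.ofReal (rootWeight v) :=
    (continuous_rootWeight r s).measurable.ennreal_ofReal
  have hS := (splitEquiv r s).measurable hA
  have hinj : Set.InjOn (coeffMapIdx : (RootIdx r s → ℝ) → _) (splitEquiv r s ⁻¹' A) := by
    intro u hu u' hu' h
    have := congrArg (relabel r s) h
    rw [relabel_coeffMapIdx, relabel_coeffMapIdx] at this
    exact (splitEquiv r s).injective (injOn_coeffMap r s (hAo hu) (hAo hu') this)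
  rw [image_coeffMap_eq, volume_image_relabel, ← lintegral_abs_det_fderiv_eq_addHaar_image volume
    hS (fun u _ => (differentiable_coeffMapIdx r s u).hasFDerivAt.hasFDerivWithinAt) hinj,
    ← lintegral_const_mul _ hwm,
    ← (measurePreserving_splitEquiv r s).setLIntegral_comp_preimage hA (hwm.const_mul _)]
  refine setLIntegral_congr_fun hS fun u hu => ?_
  rw [abs_det_fderiv_coeffMapIdx u (rootWeight_ne_zero (hAo hu)),
    ENNReal.ofReal_mul (by positivity), ENNReal.ofReal_pow (by positivity)]
  simp

/-- A point with distinct $x_j$ and distinct $y_j$ moves into `orderedRoots` without changing its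
coefficients; the other points form a null set, whose image under the differentiable coefficient map
is null. -/
lemma volume_image_rootSet (r s : ℕ) (B : ℝ) :
    volume (coeffMap '' rootSet r s B) =
      volume (coeffMap '' (rootSet r s B ∩ orderedRoots r s)) := by
  refine le_antisymm ?_ (measure_mono (Set.image_mono Set.inter_subset_left))
  have hN := volume_image_coeffMap_of_null (ae_iff.mp (ae_injective_rootCoords r s))
  refine (measure_mono (t := coeffMap '' (rootSet r s B ∩ orderedRoots r s) ∪ _) ?_).trans
    ((measure_union_le _ _).trans (by rw [hN, add_zero]))
  rintro _ ⟨v, hv, rfl⟩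
  by_cases h : Function.Injective v.1 ∧ Function.Injective v.2.1
  · obtain ⟨g, hg, -⟩ := existsUnique_rootAct_mem h.1 h.2 ((mem_rootSet_iff v).mp hv).2
    exact Or.inl ⟨rootAct g v, ⟨(rootAct_mem_rootSet_iff g v).mpr hv, hg⟩, coeffMap_rootAct g v⟩
  · exact Or.inr ⟨v, h, rfl⟩

/-- The set is the continuous image of a closed set intersected with an open one, hence a countable
union of compact sets. -/
lemma measurableSet_coeffSetMonic {r s : ℕ} {B : ℝ} (hB : 1 ≤ B) :
    MeasurableSet (coeffSetMonic (r + 2 * s) s B) := by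
  rw [← image_coeffMap_rootSet hB, rootSet_eq_inter]
  obtain ⟨F, hF, -, hFU, -⟩ := (isOpen_imag_ne_zero r s).exists_iUnion_isClosed
  rw [← hFU, Set.inter_iUnion, Set.image_iUnion]
  refine MeasurableSet.iUnion fun n => ?_
  have hσ : IsSigmaCompact
      ((⋂ i, {v : RootCoords r s | |coeffMap v i| ≤ B}) ∩ F n) :=
    isSigmaCompact_univ.of_isClosed_subset ((isClosed_coeff_le r s B).inter (hF n))
      (Set.subset_univ _)
  obtain ⟨K, hK, hKU⟩ := hσ.image (continuous_coeffMap r s)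
  rw [← hKU]
  exact MeasurableSet.iUnion fun m => (hK m).measurableSet

lemma volume_coeffSetMonic_le (d s : ℕ) {B : ℝ} (hB : 0 ≤ B) :
    volume (coeffSetMonic d s B) ≤ ENNReal.ofReal ((2 * B) ^ d) := by
  have hsub : coeffSetMonic d s B ⊆ Set.Icc (fun _ => -B) (fun _ => B) := by
    intro p hp
    have h : ∀ i, |p i| ≤ B := fun i => by simpa using hp.1 i.castSucc
    exact ⟨fun i => (abs_le.mp (h i)).1, fun i => (abs_le.mp (h i)).2⟩
  refine (measure_mono hsub).trans ?_
  rw [Real.volume_Icc_pi]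
  simp only [Finset.prod_const, Finset.card_univ, Fintype.card_fin]
  rw [← ENNReal.ofReal_pow (by linarith)]
  exact ENNReal.ofReal_le_ofReal (by rw [sub_neg_eq_add, ← two_mul])

lemma mul_volume_coeffSetMonic {r s : ℕ} {B : ℝ} (hB : 1 ≤ B) :
    (r.factorial * (s.factorial * 2 ^ s) : ℕ) * volume (coeffSetMonic (r + 2 * s) s B) =
      4 ^ s * ∫⁻ v in rootSet r s B, ENNReal.ofReal (rootWeight v) := by
  rw [← image_coeffMap_rootSet hB, volume_image_rootSet, volume_image_coeffMap_of_ordered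
    ((measurableSet_rootSet r s B).inter (measurableSet_orderedRoots r s))
    Set.inter_subset_right, lintegral_rootSet_eq, mul_left_comm]

/-- Finiteness is read off the volume side, where the coefficients lie in a cube. -/
lemma integrableOn_rootWeight {r s : ℕ} {B : ℝ} (hB : 1 ≤ B) :
    IntegrableOn (fun v : RootCoords r s => rootWeight v) (rootSet r s B) volume := by
  refine ⟨(continuous_rootWeight r s).aestronglyMeasurable, ?_⟩
  rw [hasFiniteIntegral_iff_ofReal (Filter.Eventually.of_forall rootWeight_nonneg)]
  have h := mul_volume_coeffSetMonic (r := r) (s := s) hB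
  have hfin : volume (coeffSetMonic (r + 2 * s) s B) < ⊤ :=
    (volume_coeffSetMonic_le _ _ (by linarith)).trans_lt ENNReal.ofReal_lt_top
  have h2 : 4 ^ s * ∫⁻ v in rootSet r s B, ENNReal.ofReal (rootWeight v) < ⊤ := by
    rw [← h]
    exact ENNReal.mul_lt_top (ENNReal.natCast_lt_top _) hfin
  by_contra htop
  rw [not_lt, top_le_iff] at htop
  rw [htop, ENNReal.mul_top (by positivity)] at h2
  exact lt_irrefl _ h2

lemma volume_real_coeffSetMonic {r s : ℕ} {B : ℝ} (hB : 1 ≤ B) :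
    volume.real (coeffSetMonic (r + 2 * s) s B) =
      (2 : ℝ) ^ s / ((r.factorial : ℝ) * (s.factorial : ℝ)) *
        ∫ v in rootSet r s B, rootWeight v := by
  have h := congrArg ENNReal.toReal (mul_volume_coeffSetMonic (r := r) (s := s) hB)
  rw [ENNReal.toReal_mul, ENNReal.toReal_mul, ← integral_eq_lintegral_of_nonneg_ae
    (Filter.Eventually.of_forall rootWeight_nonneg)
    (continuous_rootWeight r s).aestronglyMeasurable, ← Measure.real] at h
  have h4 : (4 : ℝ) ^ s = 2 ^ s * 2 ^ s := by rw [← mul_pow]; norm_num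
  simp only [ENNReal.toReal_natCast, ENNReal.toReal_pow, ENNReal.toReal_ofNat, h4] at h
  push_cast at h
  have hr : (r.factorial : ℝ) ≠ 0 := by positivity
  have hs : (s.factorial : ℝ) ≠ 0 := by positivity
  field_simp
  apply mul_left_cancel₀ (pow_ne_zero s (two_ne_zero (α := ℝ)))
  linear_combination h

/-! ### Slicing by the leading coefficient -/

open scoped Pointwise

lemma hasSignature_toPoly_smul {d s : ℕ} {t : ℝ} (ht : t ≠ 0) (p : Fin (d + 1) → ℝ) :
    HasSignature (toPoly (t • p)) s ↔ HasSignature (toPoly p) s := by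
  have h : toPoly (t • p) = C t * toPoly p := by
    simp [toPoly, Finset.mul_sum, mul_assoc]
  rw [h, HasSignature, HasSignature, aroots_C_mul _ ht]

lemma smul_mem_coeffSet_iff {d s : ℕ} {B t : ℝ} (ht : 0 < t) (p : Fin (d + 1) → ℝ) :
    t • p ∈ coeffSet d s B ↔ p ∈ coeffSet d s (B / t) := by
  simp only [coeffSet, Set.mem_ofPred_eq, hasSignature_toPoly_smul ht.ne', Pi.smul_apply,
    smul_eq_mul, abs_mul, abs_of_pos ht, le_div_iff₀' ht]

lemma snoc_eq_smul {d : ℕ} {t : ℝ} (ht : t ≠ 0) (q : Fin d → ℝ) :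
    (Fin.snoc q t : Fin (d + 1) → ℝ) = t • (Fin.snoc (t⁻¹ • q) 1 : Fin (d + 1) → ℝ) := by
  ext i
  refine Fin.lastCases ?_ (fun j => ?_) i
  · simp
  · simp [mul_inv_cancel_left₀ ht]

lemma snoc_mem_coeffSet_iff {d s : ℕ} {B t : ℝ} (ht : 0 < t) (q : Fin d → ℝ) :
    (Fin.snoc q t : Fin (d + 1) → ℝ) ∈ coeffSet d s B ↔
      t⁻¹ • q ∈ coeffSetMonic d s (B / t) := by
  rw [snoc_eq_smul ht.ne', smul_mem_coeffSet_iff ht]; rfl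

lemma measurableSet_monic_hasSignature (r s : ℕ) :
    MeasurableSet {q : Fin (r + 2 * s) → ℝ |
      HasSignature (toPoly (Fin.snoc q 1 : Fin (r + 2 * s + 1) → ℝ)) s} := by
  have h : {q : Fin (r + 2 * s) → ℝ |
      HasSignature (toPoly (Fin.snoc q 1 : Fin (r + 2 * s + 1) → ℝ)) s} =
      ⋃ n : ℕ, coeffSetMonic (r + 2 * s) s (n + 1) := by
    ext q
    simp only [Set.mem_iUnion, Set.mem_ofPred_eq, coeffSetMonic, coeffSet]
    refine ⟨fun hq => ?_, fun ⟨_, hq⟩ => hq.2⟩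
    obtain ⟨n, hn⟩ := exists_nat_ge ‖(Fin.snoc q 1 : Fin (r + 2 * s + 1) → ℝ)‖
    refine ⟨n, fun i => ?_, hq⟩
    have := norm_le_pi_norm (Fin.snoc q 1 : Fin (r + 2 * s + 1) → ℝ) i
    rw [Real.norm_eq_abs] at this
    linarith
  rw [h]
  exact MeasurableSet.iUnion fun n => measurableSet_coeffSetMonic (by simp)

/-- Dividing by the positive leading coefficient keeps the roots and reduces the signature condition
to the monic case. -/
lemma measurableSet_coeffSetPos (r s : ℕ) (B : ℝ) :
    MeasurableSet (coeffSetPos (r + 2 * s) s B) := by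
  have h : coeffSetPos (r + 2 * s) s B =
      (⋂ i, {p | |p i| ≤ B}) ∩ ({p | 0 < p (Fin.last _)} ∩
        (fun (p : Fin (r + 2 * s + 1) → ℝ) (i : Fin (r + 2 * s)) =>
          (p (Fin.last _))⁻¹ * p i.castSucc) ⁻¹'
        {q | HasSignature (toPoly (Fin.snoc q 1 : Fin (r + 2 * s + 1) → ℝ)) s}) := by
    ext p
    simp only [coeffSetPos, coeffSet, Set.mem_inter_iff, Set.mem_iInter, Set.mem_ofPred_eq,
      Set.mem_preimage, and_assoc]
    refine and_congr_right fun _ => ?_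
    rw [and_comm]
    refine and_congr_right fun hp => ?_
    have hs := snoc_eq_smul hp.ne' (Fin.init p)
    rw [Fin.snoc_init_self] at hs
    rw [hs, hasSignature_toPoly_smul hp.ne', ← hs]
    rfl
  rw [h]
  refine (MeasurableSet.iInter fun i => measurableSet_le (by fun_prop) (by fun_prop)).inter
    ((measurableSet_lt (by fun_prop) (by fun_prop)).inter
      (MeasurableSet.preimage (measurableSet_monic_hasSignature r s) ?_))
  fun_prop

/-- The vectors `q` such that `(q, t)` lies in `𝓗_d^+(s, B)`. -/
def posSection (d s : ℕ) (B t : ℝ) : Set (Fin d → ℝ) :=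
  {q | (Fin.snoc q t : Fin (d + 1) → ℝ) ∈ coeffSetPos d s B}

lemma posSection_eq_smul {d s : ℕ} {B t : ℝ} (ht : 0 < t) :
    posSection d s B t = t • coeffSetMonic d s (B / t) := by
  ext q
  rw [Set.mem_smul_set_iff_inv_smul_mem₀ ht.ne', ← snoc_mem_coeffSet_iff ht]
  simp [posSection, coeffSetPos, ht]

lemma posSection_eq_empty {d s : ℕ} {B t : ℝ} (ht : t ∉ Set.Ioc 0 B) :
    posSection d s B t = ∅ := by
  refine Set.eq_empty_of_forall_notMem fun q hq => ht ⟨?_, ?_⟩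
  · simpa using hq.2
  · simpa using (le_abs_self _).trans (hq.1.1 (Fin.last d))

lemma volume_real_posSection {d s : ℕ} {B t : ℝ} (ht : 0 < t) :
    volume.real (posSection d s B t) = t ^ d * volume.real (coeffSetMonic d s (B / t)) := by
  rw [posSection_eq_smul ht, Measure.real, Measure.addHaar_smul, ENNReal.toReal_mul,
    Module.finrank_fin_fun, abs_of_pos (by positivity), ENNReal.toReal_ofReal (by positivity)]
  rfl

/-- The factor $t^d$ cancels the growth of the cube of side $2B/t$, so the bound is uniform in $t$.
-/
lemma volume_posSection_le {d s : ℕ} {B t : ℝ} (hB : 0 < B) :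
    volume (posSection d s B t) ≤ ENNReal.ofReal ((2 * B) ^ d) := by
  by_cases ht : t ∈ Set.Ioc 0 B
  · rw [posSection_eq_smul ht.1, Measure.addHaar_smul, Module.finrank_fin_fun,
      abs_of_pos (pow_pos ht.1 d)]
    refine (mul_le_mul_right (volume_coeffSetMonic_le d s (div_nonneg hB.le ht.1.le)) _).trans ?_
    rw [← ENNReal.ofReal_mul (pow_pos ht.1 d).le, ← mul_pow]
    refine ENNReal.ofReal_le_ofReal (le_of_eq ?_)
    congr 1
    have := ht.1.ne'
    field_simp
  · rw [posSection_eq_empty ht]; simp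

lemma measurePreserving_snoc (d : ℕ) :
    MeasurePreserving (fun x : ℝ × (Fin d → ℝ) => (Fin.snoc x.2 x.1 : Fin (d + 1) → ℝ))
      volume volume := by
  have h : (fun x : ℝ × (Fin d → ℝ) => (Fin.snoc x.2 x.1 : Fin (d + 1) → ℝ)) =
      (MeasurableEquiv.piFinSuccAbove (fun _ : Fin (d + 1) => ℝ) (Fin.last d)).symm := by
    funext x
    exact (Fin.insertNth_last' x.1 x.2).symm
  rw [h]
  exact (volume_preserving_piFinSuccAbove (fun _ : Fin (d + 1) => ℝ) (Fin.last d)).symm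

lemma measurable_volume_posSection (r s : ℕ) (B : ℝ) :
    Measurable fun t => volume (posSection (r + 2 * s) s B t) :=
  measurable_measure_prodMk_left
    ((measurePreserving_snoc _).measurable (measurableSet_coeffSetPos r s B))

lemma volume_coeffSetPos (r s : ℕ) (B : ℝ) :
    volume (coeffSetPos (r + 2 * s) s B) =
      ∫⁻ t in Set.Ioc 0 B, volume (posSection (r + 2 * s) s B t) := by
  have hm := measurableSet_coeffSetPos r s B
  rw [← (measurePreserving_snoc _).measure_preimage hm.nullMeasurableSet, Measure.volume_eq_prod,
    Measure.prod_apply ((measurePreserving_snoc _).measurable hm),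
    ← lintegral_indicator measurableSet_Ioc]
  refine lintegral_congr fun t => ?_
  by_cases ht : t ∈ Set.Ioc 0 B
  · rw [Set.indicator_of_mem ht]; rfl
  · rw [Set.indicator_of_notMem ht]
    have := posSection_eq_empty (d := r + 2 * s) (s := s) ht
    exact (congrArg volume this).trans measure_empty

lemma volume_coeffSetPos_ne_top {r s : ℕ} {B : ℝ} (hB : 0 < B) :
    volume (coeffSetPos (r + 2 * s) s B) ≠ ⊤ := by
  rw [volume_coeffSetPos]
  refine ((setLIntegral_mono measurable_const fun t _ => volume_posSection_le hB).trans_lt ?_).ne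
  rw [setLIntegral_const, Real.volume_Ioc]
  exact ENNReal.mul_lt_top ENNReal.ofReal_lt_top ENNReal.ofReal_lt_top

lemma volume_real_coeffSetPos {r s : ℕ} {B : ℝ} (hB : 0 < B) :
    volume.real (coeffSetPos (r + 2 * s) s B) =
      ∫ t in (0 : ℝ)..B,
        t ^ (r + 2 * s) * volume.real (coeffSetMonic (r + 2 * s) s (B / t)) := by
  rw [Measure.real, volume_coeffSetPos, intervalIntegral.integral_of_le hB.le,
    ← integral_toReal (measurable_volume_posSection r s B).aemeasurable
      (Filter.Eventually.of_forall fun t =>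
        (volume_posSection_le hB).trans_lt ENNReal.ofReal_lt_top)]
  exact setIntegral_congr_fun measurableSet_Ioc fun t ht => volume_real_posSection ht.1

lemma intervalIntegrable_pow_mul_volume {r s : ℕ} {B : ℝ} (hB : 0 < B) :
    IntervalIntegrable
      (fun t : ℝ => t ^ (r + 2 * s) * volume.real (coeffSetMonic (r + 2 * s) s (B / t)))
      volume 0 B := by
  rw [intervalIntegrable_iff_integrableOn_Ioc_of_le hB.le]
  refine IntegrableOn.congr_fun (f := fun t => volume.real (posSection (r + 2 * s) s B t)) ?_
    (fun t ht => volume_real_posSection ht.1) measurableSet_Ioc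
  refine Measure.integrableOn_of_bounded (M := (2 * B) ^ (r + 2 * s)) (by simp)
    (measurable_volume_posSection r s B).ennreal_toReal.aestronglyMeasurable
    (Filter.Eventually.of_forall fun t => ?_)
  rw [Real.norm_of_nonneg measureReal_nonneg]
  exact ENNReal.toReal_le_of_le_ofReal (by positivity) (volume_posSection_le hB)

lemma integral_pow_mul_volume_scale {d s : ℕ} {B : ℝ} (hB : 0 < B) :
    ∫ t in (0 : ℝ)..B, t ^ d * volume.real (coeffSetMonic d s (B / t)) =
      B ^ (d + 1) *
        ∫ u in (0 : ℝ)..1, u ^ d * volume.real (coeffSetMonic d s (1 / u)) := by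
  have h := intervalIntegral.integral_comp_mul_left (a := 0) (b := 1)
    (fun t => t ^ d * volume.real (coeffSetMonic d s (B / t))) hB.ne'
  rw [mul_zero, mul_one, smul_eq_mul, eq_inv_mul_iff_mul_eq₀ hB.ne'] at h
  rw [← h, pow_succ', mul_assoc, ← intervalIntegral.integral_const_mul (B ^ d)]
  congr 2
  ext u
  rw [mul_pow, mul_assoc, ← div_div, div_self hB.ne']

end BoundedHeight

end

theorem theorem2 (d r s : ℕ) (hd : 0 < d) (hrs : d = r + 2 * s) :
    (∀ B : ℝ, 1 ≤ B →
      NullMeasurableSet (BoundedHeight.coeffSetMonic d s B) volume ∧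
      volume (BoundedHeight.coeffSetMonic d s B) ≠ ⊤ ∧
      NullMeasurableSet (BoundedHeight.rootSet r s B) volume ∧
      IntegrableOn (fun v : BoundedHeight.RootCoords r s => BoundedHeight.rootWeight v)
        (BoundedHeight.rootSet r s B) volume ∧
      volume.real (BoundedHeight.coeffSetMonic d s B) =
        (2 : ℝ) ^ s / ((r.factorial : ℝ) * (s.factorial : ℝ)) *
          ∫ v in BoundedHeight.rootSet r s B, BoundedHeight.rootWeight v) ∧
    (∀ B : ℝ, 0 < B →
      NullMeasurableSet (BoundedHeight.coeffSetPos d s B) volume ∧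
      volume (BoundedHeight.coeffSetPos d s B) ≠ ⊤ ∧
      IntervalIntegrable
        (fun u : ℝ => u ^ d * volume.real (BoundedHeight.coeffSetMonic d s (1 / u)))
        volume 0 1 ∧
      volume.real (BoundedHeight.coeffSetPos d s B) =
        B ^ (d + 1) *
          ∫ u in (0 : ℝ)..1,
            u ^ d * volume.real (BoundedHeight.coeffSetMonic d s (1 / u))) := by
  subst hrs
  refine ⟨fun B hB => ⟨?_, ?_, ?_, ?_, ?_⟩, fun B hB => ⟨?_, ?_, ?_, ?_⟩⟩
  · exact (BoundedHeight.measurableSet_coeffSetMonic hB).nullMeasurableSet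
  · exact ((BoundedHeight.volume_coeffSetMonic_le _ _ (by linarith)).trans_lt
      ENNReal.ofReal_lt_top).ne
  · exact (BoundedHeight.measurableSet_rootSet r s B).nullMeasurableSet
  · exact BoundedHeight.integrableOn_rootWeight hB
  · exact BoundedHeight.volume_real_coeffSetMonic hB
  · exact (BoundedHeight.measurableSet_coeffSetPos r s B).nullMeasurableSet
  · exact BoundedHeight.volume_coeffSetPos_ne_top hB
  -- The integrand in $u$ is the slice volume for the bound 1, whatever $B$ is.
  · exact BoundedHeight.intervalIntegrable_pow_mul_volume one_pos
  · rw [BoundedHeight.volume_real_coeffSetPos hB,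
      BoundedHeight.integral_pow_mul_volume_scale hB]
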